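/- All Hilbert spaces are finite-dimensional. Let $\mathcal C$ be a set of quantum channels (completely positive trace-preserving linear maps) $\mathcal L(\mathcal H_1)\to\mathcal L(\mathcal H_2)$, with $\mathcal H_1\neq 0$, and let $N,M\in\mathbb N$. (Cloning is the case $M>N$, $\mathcal H_1=\mathcal H_2$.) For states let $F(\rho,\sigma)=\mathrm{tr}\,|\sqrt\rho\sqrt\sigma|$ and $D(\rho,\sigma)=\arccos F(\rho,\sigma)$. For channels $\mathcal A,\mathcal B:\mathcal L(\mathcal K)\to\mathcal L(\mathcal K')$ let $F_{\rm CJ}(\mathcal A,\mathcal B)=F((\mathrm{id}\otimes\mathcal A)[\Phi^+],(\mathrm{id}\otimes\mathcal B)[\Phi^+])$, with $\Phi^+$ the maximally entangled state on $\mathcal K\otimes\mathcal K$, and $F_\diamond(\mathcal A,\mathcal B)=\min_\Psi F((\mathrm{id}\otimes\mathcal A)[\Psi],(\mathrm{id}\otimes\mathcal B)[\Psi])$ over pure states $\Psi$ on $\mathcal K\otimes\mathcal K$; and let $D_\bullet=\arccos F_\bullet$ for $\bullet\in\{{\rm CJ},\diamond\}$. An $N$-slot process $\mathbf P$ is a linear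 map from $\mathcal L(\mathcal H_1^{\otimes N})\to\mathcal L(\mathcal H_2^{\otimes N})$ maps to $\mathcal L(\mathcal H_{\rm in})\to\mathcal L(\mathcal H_{\rm out})$ maps, and $\mathbf P[\mathcal E^{\times N}]:=\mathbf P(\mathcal E^{\otimes N})$. Three classes of processes are considered: - *general* (not necessarily causally ordered): all trivial extensions of $\mathbf P$ send completely positive maps to completely positive maps, and $\mathbf P(\mathcal E_1\otimes\dots\otimes\mathcal E_N)$ is trace preserving whenever all $\mathcal E_t$ are; - *sequential* (causally ordered): $\mathbf P(\mathcal E_1\otimes\dots\otimes\mathcal E_N)=\mathcal V_N\circ(\mathrm{id}\otimes\mathcal E_N)\circ\mathcal V_{N-1}\circ\dots\circ(\mathrm{id}\otimes\mathcal E_1)\circ\mathcal V_0$ for fixed channels $\mathcal V_t$, the identities acting on memories of arbitrary finite dimension; - *parallel*: $\mathbf P(\mathcal E_1\otimes\dots\otimes\mathcal E_N)=\mathcal W\circ(\mathrm{id}\otimes\mathcal E_1\otimes\dots\otimes\mathcal E_N)\circ\mathcal V$ for fixed channels $\mathcal V,\mathcal W$, the identity acting on a memory of arbitrary finite dimension.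 Fix one of these classes. The optimal $N\to M$ cloning fidelity and distance are $$\mathsf F^{\mathcal C}_\bullet=\sup_{\mathbf P}\inf_{\mathcal E\in\mathcal C}F_\bullet\big(\mathbf P[\mathcal E^{\times N}],\mathcal E^{\otimes M}\big),\qquad \mathsf D^{\mathcal C}_\bullet=\arccos\mathsf F^{\mathcal C}_\bullet,$$ the supremum being over the processes $\mathbf P$ of the class with $\mathcal H_{\rm in}=\mathcal H_1^{\otimes M}$ and $\mathcal H_{\rm out}=\mathcal H_2^{\otimes M}$. The optimal $N$-copy discrimination distance is $$\mathsf D^{(N)}(\mathcal E_0,\mathcal E_1)=\sup_{\mathbf S}D\big(\mathbf S[\mathcal E_0^{\times N}],\mathbf S[\mathcal E_1^{\times N}]\big),$$ the supremum being over the state-producing processes $\mathbf S$ of the same class ($\dim\mathcal H_{\rm in}=1$, $\mathcal H_{\rm out}$ of arbitrary finite dimension). Then, for each of the three classes, for $\bullet\in\{{\rm CJ},\diamond\}$ and for all $\mathcal E_0,\mathcal E_1\in\mathcal C$, $$\mathsf D^{\mathcal C}_\bullet\;\ge\;\tfrac12\Big(D_\bullet\big(\mathcal E_0^{\otimes M},\mathcal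 E_1^{\otimes M}\big)-\mathsf D^{(N)}(\mathcal E_0,\mathcal E_1)\Big).$$ -/

import Mathlib

open scoped MatrixOrder ComplexOrder Matrix Kronecker

noncomputable section

namespace ChannelCloning

/-- Operators on the Hilbert space with (finite) orthonormal basis indexed by `n`. The tensor
product of spaces indexed by `a` and `n` is indexed by `a × n`, the `N`-fold tensor power of the
space indexed by `n` by `Fin N → n`, and the trivial (one-dimensional) space by `Unit`. -/
abbrev Op (n : Type) := Matrix n n ℂ

/-- Linear maps from the operators on one space to the operators on another. -/
abbrev OpMap (n m : Type) := Op n →ₗ[ℂ] Op m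

/-! ### States -/

/-- The (root) fidelity `F(ρ, σ) = tr |√ρ √σ|`. -/
def fidelity {n : Type} [Fintype n] [DecidableEq n] (ρ σ : Op n) : ℝ :=
  (CFC.abs (CFC.sqrt ρ * CFC.sqrt σ)).trace.re

/-- The Bures angle `D(ρ, σ) = arccos F(ρ, σ)`. -/
def buresAngle {n : Type} [Fintype n] [DecidableEq n] (ρ σ : Op n) : ℝ :=
  Real.arccos (fidelity ρ σ)

/-- The rank-one operator `|ψ⟩⟨ψ|`. -/
def ketbra {n : Type} (ψ : n → ℂ) : Op n := Matrix.vecMulVec ψ (star ψ)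

/-- The maximally entangled vector `|Φ⁺⟩ = d^{-1/2} ∑ i, |i i⟩`. -/
def maxEntangled (n : Type) [Fintype n] [DecidableEq n] : n × n → ℂ :=
  fun p => if p.1 = p.2 then ((1 / Real.sqrt (Fintype.card n) : ℝ) : ℂ) else 0

/-! ### Channels -/

/-- The map `id_a ⊗ Φ`. -/
def idTensor (a : Type) {n m : Type} (Φ : OpMap n m) : OpMap (a × n) (a × m) where
  toFun X := Matrix.of fun p q => Φ (Matrix.of fun i j => X (p.1, i) (q.1, j)) p.2 q.2
  map_add' X Y := by
    ext p q
    exact congrFun (congrFun (Φ.map_add (Matrix.of fun i j => X (p.1, i) (q.1, j))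
      (Matrix.of fun i j => Y (p.1, i) (q.1, j))) p.2) q.2
  map_smul' c X := by
    ext p q
    exact congrFun (congrFun (Φ.map_smul c (Matrix.of fun i j => X (p.1, i) (q.1, j))) p.2) q.2

/-- Complete positivity: all the maps `id_a ⊗ Φ` send positive semidefinite operators to positive
semidefinite operators. -/
def IsCP {n m : Type} (Φ : OpMap n m) : Prop :=
  ∀ (a : Type) [Fintype a] (X : Op (a × n)), X.PosSemidef → (idTensor a Φ X).PosSemidef

/-- Trace preservation. -/
def IsTP {n m : Type} [Fintype n] [Fintype m] (Φ : OpMap n m) : Prop :=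
  ∀ X : Op n, (Φ X).trace = X.trace

/-- Quantum channels: completely positive and trace-preserving linear maps. -/
def IsChannel {n m : Type} [Fintype n] [Fintype m] (Φ : OpMap n m) : Prop :=
  IsCP Φ ∧ IsTP Φ

/-- The tensor product `E 0 ⊗ ⋯ ⊗ E (N - 1)` of `N` linear maps. -/
def tensorMap {N : ℕ} {n m : Type} [Fintype n] [DecidableEq n] (E : Fin N → OpMap n m) :
    OpMap (Fin N → n) (Fin N → m) where
  toFun X := Matrix.of fun k l => ∑ i : Fin N → n, ∑ j : Fin N → n,
    X i j * ∏ t, E t (Matrix.single (i t) (j t) 1) (k t) (l t)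
  map_add' X Y := by
    ext k l
    simp [add_mul, Finset.sum_add_distrib]
  map_smul' c X := by
    ext k l
    simp [mul_assoc, Finset.mul_sum]

/-- The tensor power `E^{⊗N}`. -/
def tensorPow (N : ℕ) {n m : Type} [Fintype n] [DecidableEq n] (E : OpMap n m) :
    OpMap (Fin N → n) (Fin N → m) :=
  tensorMap fun _ => E

/-- The Choi-Jamiolkowski operator `CJ[A] = (id ⊗ A)[|Φ⁺⟩⟨Φ⁺|]`. -/
def choiState {n m : Type} [Fintype n] [DecidableEq n] (A : OpMap n m) : Op (n × m) :=
  idTensor n A (ketbra (maxEntangled n))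

/-- The two figures of merit for channels. -/
inductive Merit
  /-- The Choi-Jamiolkowski fidelity. -/
  | choi
  /-- The diamond (worst-case) fidelity. -/
  | diamond

/-- The fidelity of two channels for either figure of merit: `F(CJ[A], CJ[B])`, respectively the
minimum of `F((id ⊗ A)[Ψ], (id ⊗ B)[Ψ])` over the pure states `Ψ` of the input system and a
reference system of the same dimension. -/
def channelFidelity {n m : Type} [Fintype n] [DecidableEq n] [Fintype m] [DecidableEq m] :
    Merit → OpMap n m → OpMap n m → ℝ
  | .choi, A, B => fidelity (choiState A) (choiState B)
  | .diamond, A, B => ⨅ ψ : {ψ : n × n → ℂ // ∑ p, ‖ψ p‖ ^ 2 = 1},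
      fidelity (idTensor n A (ketbra ψ.1)) (idTensor n B (ketbra ψ.1))

/-- The corresponding distance of two channels, `arccos` of the fidelity. -/
def channelDist {n m : Type} [Fintype n] [DecidableEq n] [Fintype m] [DecidableEq m]
    (f : Merit) (A B : OpMap n m) : ℝ :=
  Real.arccos (channelFidelity f A B)

/-! ### Processes -/

/-- Linear maps from `L(H₁^{⊗N} → H₂^{⊗N})` to `L(H_in → H_out)`. -/
abbrev ProcMap (N : ℕ) (n m i o : Type) := OpMap (Fin N → n) (Fin N → m) →ₗ[ℂ] OpMap i o

/-- The component `Y ↦ ⟨β| F(|α⟩⟨α'| ⊗ Y) |β'⟩` of a map `F` on extended systems. -/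
def component {a b x y : Type} [DecidableEq a] (F : OpMap (a × x) (b × y)) (α α' : a) (β β' : b) :
    OpMap x y where
  toFun Y := Matrix.of fun k l => F (Matrix.single α α' (1 : ℂ) ⊗ₖ Y) (β, k) (β', l)
  map_add' Y Z := by
    ext k l
    simp [Matrix.kronecker_add]
  map_smul' c Y := by
    ext k l
    simp [Matrix.kronecker_smul]

/-- The trivial extension `id ⊗ P` of a linear map `P` of linear maps, evaluated at a map `F` with
an extra input `a` and an extra output `b` that `P` does not touch. -/
def extend {x y i o : Type} (P : OpMap x y →ₗ[ℂ] OpMap i o) {a b : Type} [Fintype a]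
    [DecidableEq a] (F : OpMap (a × x) (b × y)) : OpMap (a × i) (b × o) where
  toFun X := Matrix.of fun p q => ∑ α : a, ∑ α' : a,
    P (component F α α' p.1 q.1) (Matrix.of fun s t => X (α, s) (α', t)) p.2 q.2
  map_add' X Y := by
    ext p q
    simp only [Matrix.of_apply, Matrix.add_apply, ← Finset.sum_add_distrib]
    refine Finset.sum_congr rfl fun α _ => Finset.sum_congr rfl fun α' _ => ?_
    exact congrFun (congrFun ((P (component F α α' p.1 q.1)).map_add
      (Matrix.of fun s t => X (α, s) (α', t)) (Matrix.of fun s t => Y (α, s) (α', t))) p.2) q.2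
  map_smul' c X := by
    ext p q
    simp only [Matrix.of_apply, Matrix.smul_apply, Finset.smul_sum, RingHom.id_apply]
    refine Finset.sum_congr rfl fun α _ => Finset.sum_congr rfl fun α' _ => ?_
    exact congrFun (congrFun ((P (component F α α' p.1 q.1)).map_smul c
      (Matrix.of fun s t => X (α, s) (α', t))) p.2) q.2

/-- `P` is completely CP-preserving: all its trivial extensions send completely positive maps to
completely positive maps. -/
def IsCCPP {x y i o : Type} (P : OpMap x y →ₗ[ℂ] OpMap i o) : Prop :=
  ∀ (a b : Type) [Fintype a] [DecidableEq a] [Fintype b] (F : OpMap (a × x) (b × y)),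
    IsCP F → IsCP (extend P F)

/-- General (possibly not causally ordered) processes with `N` slots: completely CP-preserving,
and trace-preserving maps in the `N` slots give a trace-preserving map. -/
def IsGeneral {N : ℕ} {n m i o : Type} [Fintype n] [DecidableEq n] [Fintype m] [Fintype i]
    [Fintype o] (P : ProcMap N n m i o) : Prop :=
  IsCCPP P ∧ ∀ E : Fin N → OpMap n m, (∀ t, IsTP (E t)) → IsTP (P (tensorMap E))

/-- Sequential circuits with `N` open slots: `SeqCircuit n m i N o f` says that `f` sends the maps
`E 0, …, E (N - 1)` inserted in the slots to
`V_N ∘ (id ⊗ E (N - 1)) ∘ V_{N - 1} ∘ ⋯ ∘ (id ⊗ E 0) ∘ V_0` for some fixed channels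
`V_0, …, V_N`, where `id` acts on memories of arbitrary finite dimension. -/
inductive SeqCircuit (n m i : Type) [Fintype n] [Fintype m] [Fintype i] :
    (N : ℕ) → (o : Type) → ((Fin N → OpMap n m) → OpMap i o) → Prop
  | zero (o : Type) [Fintype o] (V : OpMap i o) (hV : IsChannel V) :
      SeqCircuit n m i 0 o fun _ => V
  | succ (N : ℕ) (a o : Type) [Fintype a] [Fintype o]
      (f : (Fin N → OpMap n m) → OpMap i (a × n)) (hf : SeqCircuit n m i N (a × n) f)
      (V : OpMap (a × m) o) (hV : IsChannel V) :
      SeqCircuit n m i (N + 1) o fun E =>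
        V ∘ₗ idTensor a (E (Fin.last N)) ∘ₗ f fun t => E t.castSucc

/-- Sequential (causally ordered) processes: those given by a sequential circuit. -/
def IsSequential {N : ℕ} {n m i o : Type} [Fintype n] [DecidableEq n] [Fintype m] [Fintype i]
    (P : ProcMap N n m i o) : Prop :=
  ∃ f : (Fin N → OpMap n m) → OpMap i o, SeqCircuit n m i N o f ∧
    ∀ E : Fin N → OpMap n m, P (tensorMap E) = f E

/-- Parallel processes: a channel, then the `N` slots in parallel next to a memory, then another
channel. -/
def IsParallel {N : ℕ} {n m i o : Type} [Fintype n] [DecidableEq n] [Fintype m] [Fintype i]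
    [Fintype o] (P : ProcMap N n m i o) : Prop :=
  ∃ (a : Type) (_ : Fintype a) (V : OpMap i (a × (Fin N → n))) (W : OpMap (a × (Fin N → m)) o),
    IsChannel V ∧ IsChannel W ∧
      ∀ E : Fin N → OpMap n m, P (tensorMap E) = W ∘ₗ idTensor a (tensorMap E) ∘ₗ V

/-- The classes of processes. -/
inductive ProcClass
  | parallel
  | sequential
  | general

/-- `P` is a process of the given class. -/
def IsProcess {N : ℕ} {n m i o : Type} [Fintype n] [DecidableEq n] [Fintype m] [Fintype i]
    [Fintype o] : ProcClass → ProcMap N n m i o → Prop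
  | .parallel, P => IsParallel P
  | .sequential, P => IsSequential P
  | .general, P => IsGeneral P

/-- The output state `S[E^{×N}]` of a process with trivial input space. -/
def outputState {N : ℕ} {n m o : Type} [Fintype n] [DecidableEq n] (S : ProcMap N n m Unit o)
    (E : OpMap n m) : Op o :=
  S (tensorPow N E) 1

/-- The optimal `N`-copy discrimination distance: the supremum of the Bures angle
`D(S[E₀^{×N}], S[E₁^{×N}])` over all state-producing processes `S` of the given class, with output
spaces of arbitrary finite dimension. -/
def discriminationDist (κ : ProcClass) (N : ℕ) {n m : Type} [Fintype n] [DecidableEq n]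
    [Fintype m] (E₀ E₁ : OpMap n m) : ℝ :=
  sSup {x : ℝ | ∃ (o : Type) (_ : Fintype o) (_ : DecidableEq o) (S : ProcMap N n m Unit o),
    IsProcess κ S ∧ x = buresAngle (outputState S E₀) (outputState S E₁)}

/-- The optimal `N → M` cloning fidelity of a set `C` of channels: the supremum over the processes
`P` of the given class of the infimum over `E ∈ C` of the fidelity of `P[E^{×N}]` and `E^{⊗M}`. -/
def cloningFidelity (f : Merit) (κ : ProcClass) (N M : ℕ) {n m : Type} [Fintype n]
    [DecidableEq n] [Fintype m] [DecidableEq m] (C : Set (OpMap n m)) : ℝ :=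
  ⨆ P : {P : ProcMap N n m (Fin M → n) (Fin M → m) // IsProcess κ P},
    ⨅ E : C, channelFidelity f (P.1 (tensorPow N E.1)) (tensorPow M E.1)

/-- The optimal `N → M` cloning distance. -/
def cloningDist (f : Merit) (κ : ProcClass) (N M : ℕ) {n m : Type} [Fintype n]
    [DecidableEq n] [Fintype m] [DecidableEq m] (C : Set (OpMap n m)) : ℝ :=
  Real.arccos (cloningFidelity f κ N M C)

end ChannelCloning

end

/-!
The optimal discrimination distance bounds how far apart any process can drive two channels, while
a good cloner has to drive `E₀` and `E₁` to the possibly much more distant channels `E₀^{⊗M}` and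
`E₁^{⊗M}`. For one process `P`, the triangle inequality gives
`D(E₀^{⊗M}, E₁^{⊗M}) ≤ D(P[E₀], E₀^{⊗M}) + D(P[E₀], P[E₁]) + D(P[E₁], E₁^{⊗M})`,
where the outer terms are at most the worst-case cloning distance of `P`.

The middle term is bounded by the discrimination distance: applying `P` to one half of a fixed
bipartite pure state (`feed`) is again a process of the same class, now with trivial input
(`IsProcess.feed`). Membership is checked for each class: memories are enlarged by the untouched
half of the state for circuits (`IsParallel.feed`, `SeqCircuit.feed`), and for general processes
every extension of the fed process is a completely positive map followed by an extension of `P`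
(`IsCCPP.feed`).

The distances of channels come from Bures angles of output states on pure inputs
(`channelDist_triangle`), so everything rests on the triangle inequality for the Bures angle
(`buresAngle_triangle`). That one follows from Uhlmann's theorem: `√ρ` can be rotated by a unitary
so that its Hilbert-Schmidt inner product with `√σ` is `F(ρ, σ)`, and no unitary gives more than the
fidelity (`exists_polar`, `re_trace_mul_le`); the Bures angle is then an angle between unit vectors.
The states involved are normalized because the processes send channels to channels
(`IsProcess.isChannel`), which uses that tensor products of completely positive maps are completely
positive (`isCP_tensorMap`, by Kraus operators).
-/

noncomputable section

namespace ChannelCloning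

/-! ### Polar decomposition and the trace norm -/

section Polar

variable {n : Type} [Fintype n] [DecidableEq n]

/-- Operators with the same modulus differ by a unitary factor on the left. -/
theorem exists_isometry_mul_eq {X Y : Op n} (h : Xᴴ * X = Yᴴ * Y) :
    ∃ U : Op n, Uᴴ * U = 1 ∧ X = U * Y := by
  let T : Op n ≃⋆ₐ[ℂ] (EuclideanSpace ℂ n →L[ℂ] EuclideanSpace ℂ n) := Matrix.toEuclideanCLM
  have hT (v : EuclideanSpace ℂ n) : ‖T X v‖ = ‖T Y v‖ := by
    have key (Z : Op n) : inner ℂ (T Z v) (T Z v) = inner ℂ v (T (Zᴴ * Z) v) := by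
      rw [map_mul, ← Matrix.star_eq_conjTranspose, map_star, ContinuousLinearMap.star_eq_adjoint,
        mul_apply_eq_comp, ContinuousLinearMap.adjoint_inner_right]
    have := (key X).trans ((congrArg (fun Z => inner ℂ v (T Z v)) h).trans (key Y).symm)
    rw [inner_self_eq_norm_sq_to_K, inner_self_eq_norm_sq_to_K] at this
    have h2 : ‖T X v‖ ^ 2 = ‖T Y v‖ ^ 2 := by exact_mod_cast this
    exact (sq_eq_sq₀ (norm_nonneg _) (norm_nonneg _)).1 h2
  let x : EuclideanSpace ℂ n →ₗ[ℂ] EuclideanSpace ℂ n := (T X).toLinearMap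
  let y : EuclideanSpace ℂ n →ₗ[ℂ] EuclideanSpace ℂ n := (T Y).toLinearMap
  -- `Y v ↦ X v` is a well-defined isometry on the range of `Y`; in finite dimension it extends to
  -- the whole space. It is written as `X ∘ g` for a right inverse `g` of `Y` on its range.
  obtain ⟨g, hg⟩ := y.rangeRestrict.exists_rightInverse_of_surjective y.range_rangeRestrict
  have hg' (s : y.range) : y (g s) = s := congrArg Subtype.val (LinearMap.congr_fun hg s)
  let V : y.range →ₗᵢ[ℂ] EuclideanSpace ℂ n :=
    { toLinearMap := x ∘ₗ g
      norm_map' := fun s => (hT (g s)).trans (congrArg norm (hg' s)) }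
  refine ⟨T.symm V.extend.toContinuousLinearMap, ?_, ?_⟩
  · apply EquivLike.injective T
    rw [map_mul, ← Matrix.star_eq_conjTranspose, map_star, map_one, T.apply_symm_apply,
      ContinuousLinearMap.star_eq_adjoint]
    exact (ContinuousLinearMap.norm_map_iff_adjoint_comp_self _).1 V.extend.norm_map
  · apply EquivLike.injective T
    rw [map_mul, T.apply_symm_apply]
    ext1 v
    have h1 : V.extend (y v) = x (g ⟨y v, v, rfl⟩) := V.extend_apply ⟨y v, v, rfl⟩
    have h2 : x (g ⟨y v, v, rfl⟩ - v) = 0 := by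
      rw [← norm_eq_zero]
      refine (hT _).trans ?_
      change ‖y _‖ = 0
      rw [map_sub, hg', sub_self, norm_zero]
    rw [map_sub, sub_eq_zero] at h2
    exact (h1.trans h2).symm

theorem posSemidef_abs (X : Op n) : (CFC.abs X).PosSemidef :=
  Matrix.nonneg_iff_posSemidef.1 (CFC.abs_nonneg X)

theorem conjTranspose_sqrt (X : Op n) : (CFC.sqrt X)ᴴ = CFC.sqrt X :=
  (Matrix.nonneg_iff_posSemidef.1 (CFC.sqrt_nonneg X)).isHermitian

/-- The polar decomposition. -/
theorem exists_polar (X : Op n) : ∃ U : Op n, Uᴴ * U = 1 ∧ X = U * CFC.abs X := by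
  apply exists_isometry_mul_eq
  have h : (CFC.abs X)ᴴ = CFC.abs X := (posSemidef_abs X).isHermitian
  rw [h, CFC.abs_mul_abs, Matrix.star_eq_conjTranspose]

/-- An operator as a vector of the Hilbert space with the Hilbert-Schmidt inner product. -/
def hsVec (A : Op n) : EuclideanSpace ℂ (n × n) := WithLp.toLp 2 fun p => A p.1 p.2

omit [DecidableEq n] in
theorem inner_hsVec (A B : Op n) : inner ℝ (hsVec A) (hsVec B) = (Aᴴ * B).trace.re := by
  rw [PiLp.inner_apply]
  simp only [hsVec, Matrix.trace, Matrix.diag, Matrix.mul_apply, Matrix.conjTranspose_apply,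
    Fintype.sum_prod_type, Complex.inner, Complex.re_sum, Complex.star_def]
  rw [Finset.sum_comm]
  simp only [mul_comm]

omit [DecidableEq n] in
theorem norm_hsVec_sq (A : Op n) : ‖hsVec A‖ ^ 2 = (Aᴴ * A).trace.re := by
  rw [← real_inner_self_eq_norm_sq, inner_hsVec]

/-- The variational bound for the trace norm: `Re tr(W X) ≤ tr |X|` for a unitary `W`, by the
Cauchy-Schwarz inequality applied to `√|X|` and `W U √|X|`, where `X = U |X|`. -/
theorem re_trace_mul_le (X W : Op n) (hW : Wᴴ * W = 1) :
    (W * X).trace.re ≤ (CFC.abs X).trace.re := by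
  obtain ⟨U, hU, hX⟩ := exists_polar X
  set S := CFC.sqrt (CFC.abs X)
  have hSS : S * S = CFC.abs X := CFC.sqrt_mul_sqrt_self _ (CFC.abs_nonneg X)
  have hSH : Sᴴ = S := conjTranspose_sqrt _
  have h1 : (W * X).trace = (Sᴴ * (W * U * S)).trace := by
    rw [hSH, Matrix.trace_mul_comm S, Matrix.mul_assoc, hSS, Matrix.mul_assoc, ← hX]
  have h2 : ‖hsVec S‖ ^ 2 = (CFC.abs X).trace.re := by rw [norm_hsVec_sq, hSH, hSS]
  have h3 : ‖hsVec (W * U * S)‖ ^ 2 = (CFC.abs X).trace.re := by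
    rw [norm_hsVec_sq, ← hSS, Matrix.conjTranspose_mul, Matrix.conjTranspose_mul, hSH]
    congr 2
    calc S * (Uᴴ * Wᴴ) * (W * U * S) = S * (Uᴴ * (Wᴴ * W) * U) * S := by noncomm_ring
      _ = S * S := by rw [hW, Matrix.mul_one, hU, Matrix.mul_one]
  have h4 := real_inner_le_norm (hsVec S) (hsVec (W * U * S))
  rw [inner_hsVec, ← h1] at h4
  nlinarith [sq_nonneg (‖hsVec S‖ - ‖hsVec (W * U * S)‖)]

end Polar

/-! ### The Bures angle -/

section Bures

variable {n : Type} [Fintype n] [DecidableEq n]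

theorem fidelity_nonneg (ρ σ : Op n) : 0 ≤ fidelity ρ σ :=
  (Complex.nonneg_iff.1 (posSemidef_abs _).trace_nonneg).1

theorem fidelity_comm (ρ σ : Op n) : fidelity ρ σ = fidelity σ ρ := by
  suffices h : ∀ ρ σ : Op n, fidelity ρ σ ≤ fidelity σ ρ from le_antisymm (h _ _) (h _ _)
  intro ρ σ
  obtain ⟨U, hU, hX⟩ := exists_polar (CFC.sqrt ρ * CFC.sqrt σ)
  have h : CFC.abs (CFC.sqrt ρ * CFC.sqrt σ) = (CFC.sqrt σ * CFC.sqrt ρ * U)ᴴ := by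
    rw [Matrix.conjTranspose_mul, Matrix.conjTranspose_mul, conjTranspose_sqrt, conjTranspose_sqrt]
    conv_rhs => rw [hX, ← Matrix.mul_assoc, hU, Matrix.one_mul]
  unfold fidelity
  rw [h, Matrix.trace_conjTranspose, Complex.star_def, Complex.conj_re, Matrix.trace_mul_comm]
  exact re_trace_mul_le _ U hU

theorem buresAngle_comm (ρ σ : Op n) : buresAngle ρ σ = buresAngle σ ρ := by
  rw [buresAngle, fidelity_comm, buresAngle]

/-- The Bures angle satisfies the triangle inequality on states. With unitaries `U`, `V` for which
`√ρ U` and `√τ V` have Hilbert-Schmidt inner products `F(ρ, σ)` and `F(τ, σ)` with `√σ`, the angle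
between `√ρ U` and `√τ V` is at least the Bures angle of `ρ` and `τ`. -/
theorem buresAngle_triangle {ρ σ τ : Op n} (hρ : ρ.PosSemidef) (hσ : σ.PosSemidef)
    (hτ : τ.PosSemidef) (hρ1 : ρ.trace = 1) (hσ1 : σ.trace = 1) (hτ1 : τ.trace = 1) :
    buresAngle ρ τ ≤ buresAngle ρ σ + buresAngle σ τ := by
  -- Uhlmann's theorem: a unitary rotation of `√ρ` realizes the fidelity with `√σ`.
  have uhlmann {ρ : Op n} (hρ : ρ.PosSemidef) (hρ1 : ρ.trace = 1) : ∃ U : Op n, Uᴴ * U = 1 ∧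
      ‖hsVec (CFC.sqrt ρ * U)‖ = 1 ∧
      inner ℝ (hsVec (CFC.sqrt ρ * U)) (hsVec (CFC.sqrt σ)) = fidelity ρ σ := by
    obtain ⟨U, hU, hX⟩ := exists_polar (CFC.sqrt ρ * CFC.sqrt σ)
    refine ⟨U, hU, ?_, ?_⟩
    · rw [← sq_eq_sq₀ (norm_nonneg _) zero_le_one, norm_hsVec_sq, Matrix.conjTranspose_mul,
        conjTranspose_sqrt, Matrix.trace_mul_comm, Matrix.mul_assoc, ← Matrix.mul_assoc U,
        mul_eq_one_comm.1 hU, Matrix.one_mul, CFC.sqrt_mul_sqrt_self ρ hρ.nonneg, hρ1]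
      simp
    · rw [inner_hsVec, Matrix.conjTranspose_mul, conjTranspose_sqrt, Matrix.mul_assoc, hX,
        ← Matrix.mul_assoc, hU, Matrix.one_mul, fidelity]
  obtain ⟨U, hU, hUn, hUi⟩ := uhlmann hρ hρ1
  obtain ⟨V, hV, hVn, hVi⟩ := uhlmann hτ hτ1
  have hσn : ‖hsVec (CFC.sqrt σ)‖ = 1 := by
    rw [← sq_eq_sq₀ (norm_nonneg _) zero_le_one, norm_hsVec_sq, conjTranspose_sqrt,
      CFC.sqrt_mul_sqrt_self σ hσ.nonneg, hσ1]
    simp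
  have h := InnerProductGeometry.angle_le_angle_add_angle (hsVec (CFC.sqrt ρ * U))
    (hsVec (CFC.sqrt σ)) (hsVec (CFC.sqrt τ * V))
  rw [InnerProductGeometry.angle_comm (hsVec (CFC.sqrt σ))] at h
  simp only [InnerProductGeometry.angle, hUn, hVn, hσn, hUi, hVi, mul_one, div_one] at h
  rw [buresAngle_comm σ τ]
  refine le_trans (Real.arccos_le_arccos ?_) h
  rw [inner_hsVec, Matrix.conjTranspose_mul, conjTranspose_sqrt, Matrix.mul_assoc,
    ← Matrix.mul_assoc (CFC.sqrt ρ), ← Matrix.mul_assoc, Matrix.trace_mul_comm, ← Matrix.mul_assoc]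
  refine re_trace_mul_le _ (V * Uᴴ) ?_
  rw [Matrix.conjTranspose_mul, Matrix.conjTranspose_conjTranspose, Matrix.mul_assoc,
    ← Matrix.mul_assoc Vᴴ, hV, Matrix.one_mul, mul_eq_one_comm.1 hU]

end Bures

/-! ### Completely positive maps and channels -/

section Channels

theorem IsCP.comp {n m o : Type} {Ψ : OpMap m o} {Φ : OpMap n m} (hΨ : IsCP Ψ) (hΦ : IsCP Φ) :
    IsCP (Ψ ∘ₗ Φ) :=
  fun a _ X hX => hΨ a _ (hΦ a X hX)

theorem IsChannel.comp {n m o : Type} [Fintype n] [Fintype m] [Fintype o] {Ψ : OpMap m o}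
    {Φ : OpMap n m} (hΨ : IsChannel Ψ) (hΦ : IsChannel Φ) : IsChannel (Ψ ∘ₗ Φ) :=
  ⟨hΨ.1.comp hΦ.1, fun X => (hΨ.2 (Φ X)).trans (hΦ.2 X)⟩

/-- A map with a Kraus decomposition is completely positive. -/
theorem IsCP.of_kraus {n m r : Type} [Fintype n] [Fintype m] [Fintype r] {Φ : OpMap n m}
    (K : r → Matrix m n ℂ) (h : ∀ X, Φ X = ∑ s, K s * X * (K s)ᴴ) : IsCP Φ := by
  classical
  intro a _ X hX
  have : idTensor a Φ X = ∑ s, ((1 : Op a) ⊗ₖ K s) * X * ((1 : Op a) ⊗ₖ K s)ᴴ := by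
    ext ⟨α, k⟩ ⟨β, l⟩
    simp only [idTensor, LinearMap.coe_mk, AddHom.coe_mk, Matrix.of_apply, h, Matrix.sum_apply]
    refine Finset.sum_congr rfl fun s _ => ?_
    simp [Matrix.mul_apply, Fintype.sum_prod_type, Matrix.one_apply, ite_mul, Finset.sum_ite_irrel,
      apply_ite star]
  rw [this]
  exact Matrix.posSemidef_sum _ fun s _ => hX.mul_mul_conjTranspose_same _

/-- The relabelling of the basis along a bijection, as a map of operators. -/
def relabel {n m : Type} (e : m ≃ n) : OpMap n m :=
  (Matrix.reindexLinearEquiv ℂ ℂ e.symm e.symm).toLinearMap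

theorem relabel_apply {n m : Type} (e : m ≃ n) (X : Op n) (k l : m) :
    relabel e X k l = X (e k) (e l) := rfl

theorem isChannel_relabel {n m : Type} [Fintype n] [Fintype m] (e : m ≃ n) :
    IsChannel (relabel e) :=
  ⟨fun a _ _ hX => hX.submatrix (Prod.map id e : a × m → a × n),
    fun X => Equiv.sum_comp e fun i => X i i⟩

theorem IsCP.idTensor {n m : Type} {Φ : OpMap n m} (hΦ : IsCP Φ) (a : Type) [Fintype a] :
    IsCP (idTensor a Φ) := by
  intro c _ X hX
  exact (hΦ (c × a) _ (hX.submatrix (Equiv.prodAssoc c a n))).submatrix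
    (Equiv.prodAssoc c a m).symm

theorem IsTP.idTensor {n m : Type} [Fintype n] [Fintype m] {Φ : OpMap n m} (hΦ : IsTP Φ)
    (a : Type) [Fintype a] : IsTP (idTensor a Φ) := by
  intro X
  simp only [Matrix.trace, Fintype.sum_prod_type]
  exact Finset.sum_congr rfl fun α _ => hΦ (Matrix.of fun i j => X (α, i) (α, j))

theorem IsChannel.idTensor {n m : Type} [Fintype n] [Fintype m] {Φ : OpMap n m}
    (hΦ : IsChannel Φ) (a : Type) [Fintype a] : IsChannel (idTensor a Φ) :=
  ⟨hΦ.1.idTensor a, hΦ.2.idTensor a⟩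

/-- A completely positive map has Kraus operators: they are the conjugated rows of a matrix `B`
with `Bᴴ B` the Choi operator `∑ i j, |i⟩⟨j| ⊗ Φ(|i⟩⟨j|)`. -/
theorem IsCP.exists_kraus {n m : Type} [Fintype n] [DecidableEq n] [Fintype m] {Φ : OpMap n m}
    (hΦ : IsCP Φ) : ∃ K : n × m → Matrix m n ℂ, ∀ i j k l,
      Φ (Matrix.single i j 1) k l = ∑ s, K s k i * star (K s l j) := by
  classical
  have hω : (ketbra fun p : n × n => if p.1 = p.2 then (1 : ℂ) else 0).PosSemidef :=
    Matrix.posSemidef_vecMulVec_self_star _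
  obtain ⟨B, hB⟩ := CStarAlgebra.nonneg_iff_eq_star_mul_self.1
    (Matrix.nonneg_iff_posSemidef.2 (hΦ n _ hω))
  refine ⟨fun s => Matrix.of fun k i => star (B s (i, k)), fun i j k l => ?_⟩
  have h := congrFun (congrFun hB (i, k)) (j, l)
  have h2 : (Matrix.of fun i' j' => (ketbra fun p : n × n => if p.1 = p.2 then (1 : ℂ) else 0)
      (i, i') (j, j')) = Matrix.single i j 1 := by
    ext i' j'
    by_cases h1 : i = i' <;> by_cases h2 : j = j' <;>
      simp [ketbra, Matrix.vecMulVec_apply, h1, h2]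
  simp only [ChannelCloning.idTensor, LinearMap.coe_mk, AddHom.coe_mk, Matrix.of_apply] at h
  rw [h2] at h
  simp only [h, Matrix.star_eq_conjTranspose, Matrix.mul_apply, Matrix.conjTranspose_apply,
    Matrix.of_apply, star_star]

/-- The Kraus operators of a tensor product are the products of Kraus operators of the factors. -/
theorem isCP_tensorMap {N : ℕ} {n m : Type} [Fintype n] [DecidableEq n] [Fintype m]
    {E : Fin N → OpMap n m} (hE : ∀ t, IsCP (E t)) : IsCP (tensorMap E) := by
  classical
  choose K hK using fun t => (hE t).exists_kraus
  refine IsCP.of_kraus (r := Fin N → n × m)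
    (fun s => Matrix.of fun k i => ∏ t, K t (s t) (k t) (i t)) fun X => ?_
  ext k l
  simp only [tensorMap, LinearMap.coe_mk, AddHom.coe_mk, Matrix.of_apply, hK, Matrix.sum_apply,
    Matrix.mul_apply, Matrix.conjTranspose_apply, Finset.prod_univ_sum, Fintype.piFinset_univ,
    Finset.mul_sum, Finset.sum_mul, star_prod, Finset.prod_mul_distrib]
  rw [Finset.sum_congr rfl fun i _ => Finset.sum_comm, Finset.sum_comm]
  refine Finset.sum_congr rfl fun s _ => ?_
  rw [Finset.sum_comm]
  refine Finset.sum_congr rfl fun j _ => Finset.sum_congr rfl fun i _ => ?_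
  ring

theorem isTP_tensorMap {N : ℕ} {n m : Type} [Fintype n] [DecidableEq n] [Fintype m]
    {E : Fin N → OpMap n m} (hE : ∀ t, IsTP (E t)) : IsTP (tensorMap E) := by
  classical
  intro X
  have h (i j : Fin N → n) : ∑ k : Fin N → m, ∏ t, E t (Matrix.single (i t) (j t) 1) (k t) (k t)
      = if i = j then 1 else 0 := by
    have h1 (t) : ∑ k, E t (Matrix.single (i t) (j t) 1) k k = if i t = j t then 1 else 0 := by
      refine (hE t _).trans ?_
      by_cases hij : i t = j t
      · simp [hij]
      · simp [hij, Matrix.trace_single_eq_of_ne]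
    have h2 := Finset.prod_univ_sum (fun _ : Fin N => (Finset.univ : Finset m))
      fun t k => E t (Matrix.single (i t) (j t) 1) k k
    rw [Fintype.piFinset_univ] at h2
    rw [← h2]
    simp only [h1, Finset.prod_ite_zero, Finset.prod_const_one, Finset.mem_univ, true_imp_iff,
      funext_iff]
  simp only [Matrix.trace, Matrix.diag, tensorMap, LinearMap.coe_mk, AddHom.coe_mk,
    Matrix.of_apply]
  rw [Finset.sum_comm]
  refine Finset.sum_congr rfl fun i _ => ?_
  rw [Finset.sum_comm]
  simp [← Finset.mul_sum, h]

theorem isChannel_tensorMap {N : ℕ} {n m : Type} [Fintype n] [DecidableEq n] [Fintype m]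
    {E : Fin N → OpMap n m} (hE : ∀ t, IsChannel (E t)) : IsChannel (tensorMap E) :=
  ⟨isCP_tensorMap fun t => (hE t).1, isTP_tensorMap fun t => (hE t).2⟩

theorem isChannel_tensorPow (N : ℕ) {n m : Type} [Fintype n] [DecidableEq n] [Fintype m]
    {E : OpMap n m} (hE : IsChannel E) : IsChannel (tensorPow N E) :=
  isChannel_tensorMap fun _ => hE

/-- The map `c ↦ c |ψ⟩⟨ψ|` from the trivial system. -/
def prepare {k : Type} (ψ : k → ℂ) : OpMap Unit k where
  toFun c := c () () • ketbra ψ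
  map_add' _ _ := add_smul _ _ _
  map_smul' _ _ := mul_smul _ _ _

theorem trace_ketbra {k : Type} [Fintype k] {ψ : k → ℂ} (hψ : ∑ p, ‖ψ p‖ ^ 2 = 1) :
    (ketbra ψ).trace = 1 := by
  simp only [ketbra, Matrix.trace, Matrix.diag, Matrix.vecMulVec_apply, Pi.star_apply,
    Complex.star_def, Complex.mul_conj, Complex.normSq_eq_norm_sq]
  exact_mod_cast hψ

theorem isChannel_prepare {k : Type} [Fintype k] {ψ : k → ℂ} (hψ : ∑ p, ‖ψ p‖ ^ 2 = 1) :
    IsChannel (prepare ψ) := by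
  refine ⟨IsCP.of_kraus (r := Unit) (fun _ => Matrix.of fun p _ => ψ p) fun X => ?_, fun X => ?_⟩
  · ext p q
    simp [prepare, ketbra, Matrix.mul_apply, Matrix.vecMulVec_apply]
    ring
  · change (X () () • ketbra ψ).trace = X.trace
    rw [Matrix.trace_smul, trace_ketbra hψ]
    simp [Matrix.trace]

end Channels

/-! ### Processes -/

section Processes

variable {N : ℕ} {n m i o : Type} [Fintype n] [DecidableEq n] [Fintype m] [Fintype i] [Fintype o]

/-- A completely CP-preserving map is CP-preserving: take one-dimensional extra systems. -/
theorem IsCCPP.isCP {x y : Type} {P : OpMap x y →ₗ[ℂ] OpMap i o} (hP : IsCCPP P) {Φ : OpMap x y}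
    (hΦ : IsCP Φ) : IsCP (P Φ) := by
  have h := hP Unit Unit (idTensor Unit Φ) (hΦ.idTensor Unit)
  have hc : component (idTensor Unit Φ) () () () () = Φ := by
    ext Y k l
    simp [component, idTensor]
    rfl
  have he : P Φ = relabel (Equiv.punitProd o).symm ∘ₗ extend P (idTensor Unit Φ) ∘ₗ
      relabel (Equiv.punitProd i) := by
    ext X k l
    simp [relabel_apply, extend, hc]
    rfl
  rw [he]
  exact (isChannel_relabel _).1.comp (h.comp (isChannel_relabel _).1)

omit [DecidableEq n] in
theorem SeqCircuit.isChannel {b : Type} {f : (Fin N → OpMap n m) → OpMap i b}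
    (hf : SeqCircuit n m i N b f) {E : Fin N → OpMap n m} (hE : ∀ t, IsChannel (E t)) :
    ∀ [Fintype b], IsChannel (f E) := by
  induction hf with
  | @zero b h V hV =>
    intro h'
    obtain rfl := Subsingleton.elim h h'
    exact hV
  | @succ N a b _ h f hf V hV ih =>
    intro h'
    obtain rfl := Subsingleton.elim h h'
    exact hV.comp (((hE _).idTensor a).comp (ih fun t => hE t.castSucc))

theorem IsProcess.isChannel {κ : ProcClass} {P : ProcMap N n m i o} (hP : IsProcess κ P)
    {E : OpMap n m} (hE : IsChannel E) : IsChannel (P (tensorPow N E)) := by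
  cases κ with
  | parallel =>
    obtain ⟨a, _, V, W, hV, hW, h⟩ := hP
    rw [tensorPow, h]
    exact hW.comp (((isChannel_tensorPow N hE).idTensor a).comp hV)
  | sequential =>
    obtain ⟨f, hf, h⟩ := hP
    rw [tensorPow, h]
    exact hf.isChannel fun _ => hE
  | general => exact ⟨hP.1.isCP (isChannel_tensorPow N hE).1, hP.2 _ fun _ => hE.2⟩

/-- The process that applies `P` to one half of the bipartite state `ψ` and keeps the other half. -/
def feed {x y k : Type} (P : OpMap x y →ₗ[ℂ] OpMap i o) (ψ : k × i → ℂ) :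
    OpMap x y →ₗ[ℂ] OpMap Unit (k × o) where
  toFun Φ := idTensor k (P Φ) ∘ₗ prepare ψ
  map_add' Φ Ψ := by rw [map_add]; rfl
  map_smul' c Φ := by rw [map_smul]; rfl

omit [Fintype m] [Fintype i] [Fintype o] in
theorem outputState_feed {k : Type} (P : ProcMap N n m i o) (ψ : k × i → ℂ) (E : OpMap n m) :
    outputState (feed P ψ) E = idTensor k (P (tensorPow N E)) (ketbra ψ) := by
  change idTensor k (P (tensorPow N E)) ((1 : ℂ) • ketbra ψ) = _
  rw [one_smul]

theorem IsParallel.feed {k : Type} [Fintype k] {P : ProcMap N n m i o} (hP : IsParallel P)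
    {ψ : k × i → ℂ} (hψ : ∑ p, ‖ψ p‖ ^ 2 = 1) : IsParallel (feed P ψ) := by
  obtain ⟨a, _, V, W, hV, hW, h⟩ := hP
  refine ⟨k × a, inferInstance, relabel (Equiv.prodAssoc k a _) ∘ₗ idTensor k V ∘ₗ prepare ψ,
    idTensor k W ∘ₗ relabel (Equiv.prodAssoc k a _).symm,
    (isChannel_relabel _).comp ((hV.idTensor k).comp (isChannel_prepare hψ)),
    (hW.idTensor k).comp (isChannel_relabel _), fun E => ?_⟩
  change idTensor k (P (tensorMap E)) ∘ₗ prepare ψ = _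
  rw [h]
  rfl

omit [DecidableEq n] [Fintype o] in
theorem SeqCircuit.comp_channel {o' : Type} [h' : Fintype o] [Fintype o']
    {f : (Fin N → OpMap n m) → OpMap i o} (hf : SeqCircuit n m i N o f) {W : OpMap o o'}
    (hW : IsChannel W) :
    SeqCircuit n m i N o' fun E => W ∘ₗ f E := by
  cases hf with
  | @zero _ h V hV =>
    obtain rfl := Subsingleton.elim h h'
    exact .zero o' _ (hW.comp hV)
  | @succ N a _ _ h f hf V hV =>
    obtain rfl := Subsingleton.elim h h'
    exact .succ N a o' f hf _ (hW.comp hV)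

omit [DecidableEq n] [Fintype o] in
/-- A sequential circuit fed with half of `ψ` is sequential: the other half joins the memory. -/
theorem SeqCircuit.feed {k : Type} [Fintype k] {f : (Fin N → OpMap n m) → OpMap i o}
    (hf : SeqCircuit n m i N o f) {ψ : k × i → ℂ} (hψ : ∑ p, ‖ψ p‖ ^ 2 = 1) :
    SeqCircuit n m Unit N (k × o) fun E => idTensor k (f E) ∘ₗ prepare ψ := by
  induction hf with
  | zero o V hV => exact .zero _ _ ((hV.idTensor k).comp (isChannel_prepare hψ))
  | succ N a o f hf V hV ih =>
    exact .succ N (k × a) (k × o) _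
      (ih.comp_channel (isChannel_relabel (Equiv.prodAssoc k a n)))
      (idTensor k V ∘ₗ relabel (Equiv.prodAssoc k a m).symm)
      ((hV.idTensor k).comp (isChannel_relabel _))

/-- Every extension of the fed process factors as the completely positive map `X ↦ X ⊗ |ψ⟩⟨ψ|`
followed by an extension of `P`, up to the order of the tensor factors. -/
theorem IsCCPP.feed {x y k : Type} [Fintype k] {P : OpMap x y →ₗ[ℂ] OpMap i o} (hP : IsCCPP P)
    (ψ : k × i → ℂ) : IsCCPP (feed P ψ) := by
  classical
  intro a b _ _ _ F hF
  -- The single Kraus operator of the map `X ↦ X ⊗ |ψ⟩⟨ψ|`, with the extra input `a` placed between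
  -- the two halves of `ψ`.
  let K : Matrix (k × (a × i)) (a × Unit) ℂ :=
    Matrix.of fun p q => if p.2.1 = q.1 then ψ (p.1, p.2.2) else 0
  let A : OpMap (a × Unit) (k × (a × i)) :=
    { toFun := fun X => K * X * Kᴴ
      map_add' := fun X Y => by rw [Matrix.mul_add, Matrix.add_mul]
      map_smul' := fun c X => by simp }
  have hA : IsCP A := .of_kraus (r := Unit) (fun _ => K) fun X => by simp [A]
  have hA' (X : Op (a × Unit)) (κ κ' : k) (α α' : a) (s t : i) :
      A X (κ, α, s) (κ', α', t) = X (α, ()) (α', ()) * (ψ (κ, s) * star (ψ (κ', t))) := by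
    simp [A, K, Matrix.mul_apply, Fintype.sum_prod_type, apply_ite star]
    ring
  let e : b × (k × o) ≃ k × (b × o) :=
    (Equiv.prodAssoc b k o).symm.trans (((Equiv.prodComm b k).prodCongr (Equiv.refl o)).trans
      (Equiv.prodAssoc k b o))
  have h : extend (ChannelCloning.feed P ψ) F =
      relabel e ∘ₗ idTensor k (extend P F) ∘ₗ A := by
    refine LinearMap.ext fun X => ?_
    ext ⟨β, κ, l⟩ ⟨β', κ', l'⟩
    change ∑ α, ∑ α', P (component F α α' β β')
        (X (α, ()) (α', ()) • Matrix.of fun s t => ketbra ψ (κ, s) (κ', t)) l l' =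
      ∑ α, ∑ α', P (component F α α' β β')
        (Matrix.of fun s t => A X (κ, α, s) (κ', α', t)) l l'
    refine Finset.sum_congr rfl fun α _ => Finset.sum_congr rfl fun α' _ => ?_
    have hZ : X (α, ()) (α', ()) • Matrix.of (fun s t => ketbra ψ (κ, s) (κ', t)) =
        Matrix.of fun s t => A X (κ, α, s) (κ', α', t) := by
      ext s t
      simp only [hA', Matrix.of_apply, Matrix.smul_apply, smul_eq_mul]
      rfl
    rw [hZ]
  rw [h]
  exact (isChannel_relabel _).1.comp (((hP a b F hF).idTensor k).comp hA)

theorem IsProcess.feed {κ : ProcClass} {k : Type} [Fintype k] {P : ProcMap N n m i o}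
    (hP : IsProcess κ P) {ψ : k × i → ℂ} (hψ : ∑ p, ‖ψ p‖ ^ 2 = 1) :
    IsProcess κ (feed P ψ) := by
  cases κ with
  | parallel => exact IsParallel.feed hP hψ
  | sequential =>
    obtain ⟨f, hf, h⟩ := hP
    refine ⟨_, hf.feed hψ, fun E => ?_⟩
    rw [← h]
    rfl
  | general =>
    refine ⟨hP.1.feed ψ, fun E hE X => ?_⟩
    exact (((hP.2 E hE).idTensor k) _).trans ((isChannel_prepare hψ).2 X)

theorem discriminationDist_nonneg (κ : ProcClass) (N : ℕ) (E₀ E₁ : OpMap n m) :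
    0 ≤ discriminationDist κ N E₀ E₁ :=
  Real.sSup_nonneg (by rintro _ ⟨_, _, _, _, _, rfl⟩; exact Real.arccos_nonneg _)

theorem buresAngle_feed_le {κ : ProcClass} {k : Type} [Fintype k] [DecidableEq k] [DecidableEq o]
    {P : ProcMap N n m i o} (hP : IsProcess κ P) {ψ : k × i → ℂ} (hψ : ∑ p, ‖ψ p‖ ^ 2 = 1)
    (E₀ E₁ : OpMap n m) :
    buresAngle (idTensor k (P (tensorPow N E₀)) (ketbra ψ))
      (idTensor k (P (tensorPow N E₁)) (ketbra ψ)) ≤ discriminationDist κ N E₀ E₁ := by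
  refine le_csSup ⟨Real.pi, ?_⟩ ⟨k × o, inferInstance, inferInstance, feed P ψ, hP.feed hψ, ?_⟩
  · rintro _ ⟨_, _, _, _, _, rfl⟩
    exact Real.arccos_le_pi _
  · rw [outputState_feed, outputState_feed]

end Processes

/-! ### Distances of channels -/

section Distance

variable {n m : Type} [Fintype n] [DecidableEq n] [Fintype m] [DecidableEq m]

theorem channelFidelity_nonneg (f : Merit) (A B : OpMap n m) : 0 ≤ channelFidelity f A B := by
  cases f with
  | choi => exact fidelity_nonneg _ _
  | diamond => exact Real.iInf_nonneg fun _ => fidelity_nonneg _ _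

theorem sum_norm_maxEntangled (n : Type) [Fintype n] [DecidableEq n] [Nonempty n] :
    ∑ p, ‖maxEntangled n p‖ ^ 2 = 1 := by
  have h : (Fintype.card n : ℝ) ≠ 0 := by simp
  simp [maxEntangled, Fintype.sum_prod_type, apply_ite norm, ite_pow, h]

/-- An upper bound for the angles bounds the angle of the infimum, whether or not the infimum is
attained. -/
theorem arccos_iInf_le {ι : Type*} [Nonempty ι] {g : ι → ℝ} {r : ℝ}
    (h : ∀ i, Real.arccos (g i) ≤ r) (hg : ∀ i, 0 ≤ g i) : Real.arccos (⨅ i, g i) ≤ r := by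
  have hr : 0 ≤ r := (Real.arccos_nonneg _).trans (h (Classical.arbitrary ι))
  rcases lt_or_ge Real.pi r with hπ | hπ
  · exact (Real.arccos_le_pi _).trans hπ.le
  rw [← Real.arccos_cos hr hπ]
  refine Real.arccos_le_arccos (le_ciInf fun i => ?_)
  by_contra! hlt
  have := Real.strictAntiOn_arccos ⟨by linarith [hg i], (hlt.trans_le (Real.cos_le_one r)).le⟩
    ⟨Real.neg_one_le_cos r, Real.cos_le_one r⟩ hlt
  rw [Real.arccos_cos hr hπ] at this
  exact (h i).not_gt this

/-- A triangle inequality for channels in which the middle distance is only needed on pure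
inputs. -/
theorem channelDist_triangle [Nonempty n] (f : Merit) {A B A' B' : OpMap n m} {r : ℝ}
    (hA : IsChannel A) (hB : IsChannel B) (hA' : IsChannel A') (hB' : IsChannel B')
    (h : ∀ ψ : n × n → ℂ, ∑ p, ‖ψ p‖ ^ 2 = 1 →
      buresAngle (idTensor n A' (ketbra ψ)) (idTensor n B' (ketbra ψ)) ≤ r) :
    channelDist f A B ≤ channelDist f A' A + r + channelDist f B' B := by
  have key (ψ : n × n → ℂ) (hψ : ∑ p, ‖ψ p‖ ^ 2 = 1) :
      buresAngle (idTensor n A (ketbra ψ)) (idTensor n B (ketbra ψ)) ≤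
        buresAngle (idTensor n A' (ketbra ψ)) (idTensor n A (ketbra ψ)) + r +
        buresAngle (idTensor n B' (ketbra ψ)) (idTensor n B (ketbra ψ)) := by
    have hps {Φ : OpMap n m} (hΦ : IsChannel Φ) : (idTensor n Φ (ketbra ψ)).PosSemidef :=
      hΦ.1 n _ (Matrix.posSemidef_vecMulVec_self_star _)
    have htr {Φ : OpMap n m} (hΦ : IsChannel Φ) : (idTensor n Φ (ketbra ψ)).trace = 1 :=
      (hΦ.2.idTensor n _).trans (trace_ketbra hψ)
    have h1 := buresAngle_triangle (hps hA) (hps hA') (hps hB) (htr hA) (htr hA') (htr hB)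
    have h2 := buresAngle_triangle (hps hA') (hps hB') (hps hB) (htr hA') (htr hB') (htr hB)
    rw [buresAngle_comm (idTensor n A _) (idTensor n A' _)] at h1
    linarith [h ψ hψ]
  cases f with
  | choi => exact key _ (sum_norm_maxEntangled n)
  | diamond =>
    have : Nonempty {ψ : n × n → ℂ // ∑ p, ‖ψ p‖ ^ 2 = 1} := ⟨⟨_, sum_norm_maxEntangled n⟩⟩
    refine arccos_iInf_le (fun ψ => (key ψ.1 ψ.2).trans ?_) fun _ => fidelity_nonneg _ _
    have hle (Φ Ψ : OpMap n m) : buresAngle (idTensor n Φ (ketbra ψ.1))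
        (idTensor n Ψ (ketbra ψ.1)) ≤ channelDist .diamond Φ Ψ :=
      Real.arccos_le_arccos (ciInf_le ⟨0, by rintro _ ⟨_, rfl⟩; exact fidelity_nonneg _ _⟩ ψ)
    linarith [hle A' A, hle B' B]

end Distance

end ChannelCloning

end

theorem proposition2 {n m : Type} [Fintype n] [DecidableEq n] [Nonempty n] [Fintype m]
    [DecidableEq m] (f : ChannelCloning.Merit) (κ : ChannelCloning.ProcClass) (N M : ℕ)
    (C : Set (ChannelCloning.OpMap n m)) (hC : ∀ E ∈ C, ChannelCloning.IsChannel E)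
    (E₀ E₁ : ChannelCloning.OpMap n m) (h₀ : E₀ ∈ C) (h₁ : E₁ ∈ C) :
    ChannelCloning.cloningDist f κ N M C ≥
      1 / 2 * (ChannelCloning.channelDist f (ChannelCloning.tensorPow M E₀)
          (ChannelCloning.tensorPow M E₁)
        - ChannelCloning.discriminationDist κ N E₀ E₁) := by
  open ChannelCloning in
  set B := 1 / 2 * (channelDist f (tensorPow M E₀) (tensorPow M E₁)
    - discriminationDist κ N E₀ E₁) with hB
  -- If the bound is not positive there is nothing to prove. That it is positive also rules out a
  -- fidelity above `1` below, where `arccos` would be zero.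
  rcases le_or_gt B 0 with hB0 | hB0
  · exact hB0.trans (Real.arccos_nonneg _)
  have hBπ : B ≤ Real.pi / 2 := by
    have h1 := discriminationDist_nonneg κ N E₀ E₁
    have h2 : channelDist f (tensorPow M E₀) (tensorPow M E₁) ≤ Real.pi := Real.arccos_le_pi _
    linarith
  rw [ge_iff_le, ← Real.arccos_cos hB0.le (by linarith [Real.pi_pos])]
  -- A nonnegative bound for each process bounds the supremum, even over an empty class.
  refine Real.arccos_le_arccos (Real.iSup_le (fun P => ?_)
    (Real.cos_nonneg_of_neg_pi_div_two_le_of_le (by linarith) hBπ))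
  set x := ⨅ E : C, channelFidelity f (P.1 (tensorPow N E.1)) (tensorPow M E.1)
  have hle {E : OpMap n m} (hE : E ∈ C) :
      channelDist f (P.1 (tensorPow N E)) (tensorPow M E) ≤ Real.arccos x :=
    Real.arccos_le_arccos (ciInf_le (f := fun E : C =>
      channelFidelity f (P.1 (tensorPow N E.1)) (tensorPow M E.1))
      ⟨0, by rintro _ ⟨_, rfl⟩; exact channelFidelity_nonneg _ _ _⟩ ⟨E, hE⟩)
  have htri := channelDist_triangle f (isChannel_tensorPow M (hC _ h₀))
    (isChannel_tensorPow M (hC _ h₁)) (P.2.isChannel (hC _ h₀)) (P.2.isChannel (hC _ h₁))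
    fun ψ hψ => buresAngle_feed_le P.2 hψ E₀ E₁
  have hBx : B ≤ Real.arccos x := by linarith [hle h₀, hle h₁]
  have hx0 : 0 ≤ x := Real.iInf_nonneg fun _ => channelFidelity_nonneg _ _ _
  have hx1 : x ≤ 1 := by
    by_contra! h
    rw [Real.arccos_of_one_le h.le] at hBx
    exact hBx.not_gt hB0
  rw [← Real.cos_arccos (by linarith) hx1]
  exact Real.cos_le_cos_of_nonneg_of_le_pi hB0.le (Real.arccos_le_pi _) hBx
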